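/- All graphs are finite and simple. For $n\ge 1$ and $S\subseteq\{1,\dots,\lfloor n/2\rfloor\}$ let $C_n(S)$ be the graph on $x_0,\dots,x_{n-1}$ in which distinct $x_a,x_b$ are adjacent if and only if $|a-b|\in S$ or $n-|a-b|\in S$; a graph isomorphic to some $C_n(S)$ is called a circulant graph. For a graph $G$ on $\{x_1,\dots,x_n\}$ and positive integers $s_1,\dots,s_n$, the expansion $G^{(s_1,\dots,s_n)}$ is the graph on the vertices $x_{i,j}$ ($1\le i\le n$, $1\le j\le s_i$) in which distinct $x_{i,j},x_{k,l}$ are adjacent if and only if $\{x_i,x_k\}$ is an edge of $G$ or $i=k$. The lexicographical product $G[H]$ has vertex set $V_G\times V_H$, with $(w,x)$ and $(y,z)$ adjacent if and only if $\{w,y\}\in E_G$, or $w=y$ and $\{x,z\}\in E_H$. $K_m$ is the complete graph on $m$ vertices. The independence complex of $G$ is the simplicial complex of all independent sets of $G$ (including $\emptyset$). The facets of a simplicial complex $\Delta$ are its inclusion-maximal faces, and $\Delta$ is pure if all facets have the same cardinality. A pure complex $\Delta$ is shellable if its facets can be ordered $F_1,\dots,F_t$ (without repetition) so that for all $1\le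 j<i\le t$ there are $x\in F_i\setminus F_j$ and $k<i$ with $F_i\setminus F_k=\{x\}$. For a vertex $x$ of $\Delta$, put $\mathrm{del}_\Delta(x)=\{A\in\Delta: x\notin A\}$ and $\mathrm{link}_\Delta(x)=\{A\in\Delta: x\notin A,\ A\cup\{x\}\in\Delta\}$. A pure complex $\Delta$ is vertex decomposable if it has a unique facet, or if there is a vertex $x$ of $\Delta$ such that $\mathrm{del}_\Delta(x)$ and $\mathrm{link}_\Delta(x)$ are both (pure and) vertex decomposable; this is a recursive definition. A graph is shellable (vertex decomposable) if its independence complex is shellable (vertex decomposable); in particular that complex is then pure. **Theorem.** Let $G=C_{16}(\{1,4,8\})$. 1. For all positive integers $s_1,\dots,s_{16}$, the expansion $G^{(s_1,\dots,s_{16})}$ is shellable but not vertex decomposable. 2. For every $m\ge 1$, $G^{(m,\dots,m)}=G[K_m]$ (the copy $x_{i,j}$ corresponding to the pair $(x_i,j)$), and this graph is a circulant graph that is shellable but not vertex decomposable. 3. The graphs $G[K_m]$, $m\ge 1$, are pairwise non-isomorphic, so they form an infinite family of circulant graphs that are shellable but not vertex decomposable. -/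

import Mathlib

/-- A simplicial complex: a family of finite subsets (faces) of `V` that is closed under taking
subsets. The empty set is allowed as a face. Its vertices are the `x : V` with `{x}` a face, so
the vertex set of a deletion or a link is in general smaller than that of the complex. -/
abbrev SimplicialCpx (V : Type*) : Type _ := LowerSet (Finset V)

namespace SimplicialCpx

variable {V : Type*}

/-- The facets are the faces that are maximal with respect to inclusion. -/
def IsFacet (Δ : SimplicialCpx V) (F : Finset V) : Prop :=
  Maximal (fun A => A ∈ Δ) F

/-- A complex is pure if all facets have the same cardinality (equivalently, dimension). -/
def IsPure (Δ : SimplicialCpx V) : Prop :=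
  ∀ F F' : Finset V, Δ.IsFacet F → Δ.IsFacet F' → F.card = F'.card

/-- The deletion of `F`: all faces that do not contain `F`. -/
def deletion (Δ : SimplicialCpx V) (F : Finset V) : SimplicialCpx V where
  carrier := {A | A ∈ Δ ∧ ¬ F ⊆ A}
  lower' := fun _ _ hle hA => ⟨Δ.lower hle hA.1, fun h => hA.2 (h.trans hle)⟩

/-- The link of `F`: all faces disjoint from `F` whose union with `F` is a face. -/
def link [DecidableEq V] (Δ : SimplicialCpx V) (F : Finset V) : SimplicialCpx V where
  carrier := {A | A ∈ Δ ∧ Disjoint F A ∧ F ∪ A ∈ Δ}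
  lower' := fun _ _ hle hA =>
    ⟨Δ.lower hle hA.1, hA.2.1.mono_right hle,
      Δ.lower (Finset.union_subset_union_right hle) hA.2.2⟩

/-- A complex is shellable if it is pure and its facets can be listed, without repetition, as
`F 0, …, F (t - 1)` such that for all `j < i` there are `x ∈ F i \ F j` and `k < i` with
`F i \ F k = {x}`. -/
def IsShellable [DecidableEq V] (Δ : SimplicialCpx V) : Prop :=
  Δ.IsPure ∧
  ∃ (t : ℕ) (F : Fin t → Finset V), Function.Injective F ∧ Set.range F = {A | Δ.IsFacet A} ∧
    ∀ i j : Fin t, j < i → ∃ x ∈ F i \ F j, ∃ k : Fin t, k < i ∧ F i \ F k = {x}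

/-- A pure complex is vertex decomposable if it is a simplex (it has a unique facet), or if it has
a vertex whose deletion and link are both vertex decomposable (in particular, pure). -/
inductive IsVertexDecomposable [DecidableEq V] : SimplicialCpx V → Prop
  | simplex (Δ : SimplicialCpx V) (hpure : Δ.IsPure) (hfacet : ∃! F : Finset V, Δ.IsFacet F) :
      IsVertexDecomposable Δ
  | shed (Δ : SimplicialCpx V) (hpure : Δ.IsPure) (x : V) (hx : ({x} : Finset V) ∈ Δ)
      (hdel : IsVertexDecomposable (Δ.deletion {x}))
      (hlink : IsVertexDecomposable (Δ.link {x})) :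
      IsVertexDecomposable Δ

end SimplicialCpx

namespace SimpleGraph

/-- The independence complex of a graph: its faces are the finite independent sets. -/
def indComplex {V : Type*} (G : SimpleGraph V) : SimplicialCpx V where
  carrier := {A | G.IsIndepSet (A : Set V)}
  lower' := fun _ _ hle hA => Set.Pairwise.mono (Finset.coe_subset.mpr hle) hA

/-- A graph is shellable if its independence complex is. -/
def IsShellable {V : Type*} [DecidableEq V] (G : SimpleGraph V) : Prop :=
  G.indComplex.IsShellable

/-- A graph is vertex decomposable if its independence complex is. -/
def IsVertexDecomposable {V : Type*} [DecidableEq V] (G : SimpleGraph V) : Prop :=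
  G.indComplex.IsVertexDecomposable

/-- The expansion of `G`: the vertex `i` is replaced by `s i` copies of itself; distinct vertices
`(i, j)` and `(k, l)` are adjacent iff `i` and `k` are adjacent in `G` or `i = k`. -/
def expansion {V : Type*} (G : SimpleGraph V) (s : V → ℕ) :
    SimpleGraph (Σ i : V, Fin (s i)) where
  Adj p q := p ≠ q ∧ (G.Adj p.1 q.1 ∨ p.1 = q.1)
  symm := ⟨fun _ _ h => ⟨h.1.symm, h.2.imp (fun h' => h'.symm) (fun h' => h'.symm)⟩⟩
  loopless := ⟨fun _ h => h.1 rfl⟩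

/-- The lexicographical product `G[H]`. -/
def lexProduct {V W : Type*} (G : SimpleGraph V) (H : SimpleGraph W) : SimpleGraph (V × W) where
  Adj p q := G.Adj p.1 q.1 ∨ (p.1 = q.1 ∧ H.Adj p.2 q.2)
  symm := ⟨fun _ _ h => h.imp (fun h' => h'.symm) (fun h' => ⟨h'.1.symm, h'.2.symm⟩)⟩
  loopless := ⟨fun _ h => h.elim (fun h' => G.irrefl h') (fun h' => H.irrefl h'.2)⟩

/-- The circulant graph `C_n(S)` for `n ≥ 1` and `S ⊆ {1, …, ⌊n/2⌋}`: its vertices are the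
residues modulo `n`, and distinct `a`, `b` are adjacent iff `a - b` or `b - a` is the residue of
an element of `S`. For representatives `0 ≤ a, b < n` this says `|a - b| ∈ S` or
`n - |a - b| ∈ S`. -/
def circulant (n : ℕ) (S : Set ℕ) : SimpleGraph (ZMod n) :=
  circulantGraph ((fun k : ℕ => (k : ZMod n)) '' S)

/-- A graph is a circulant graph if it is isomorphic to `C_n(S)` for some `n ≥ 1` and
`S ⊆ {1, …, ⌊n/2⌋}`. -/
def IsCirculant {V : Type*} (G : SimpleGraph V) : Prop :=
  ∃ (n : ℕ) (S : Set ℕ), 1 ≤ n ∧ S ⊆ Set.Icc 1 (n / 2) ∧ Nonempty (G ≃g circulant n S)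

end SimpleGraph

/-! ### Shellings from ranks, and the sign of the Euler characteristic -/

namespace SimplicialCpx

/-! An independent set of an expansion uses at most one copy of each vertex, so the independence
complex of the expansion is the `blowup` of that of `G` along the projection
(`indComplex_eq_blowup`). Everything thus reduces to one complex on 16 vertices.

Shellability goes up (`isShellable_blowup`): order facets first by the rank of their image, then by
the sum of the indices of the chosen copies. Vertex decomposability comes down
(`IsVertexDecomposable.of_blowup`): deleting one copy among several does not change the projected
complex, while deleting the last copy, or taking a link, projects to the same operation on `G`.

For `G` itself, `shelling16` is an explicit shelling checked by the kernel. The obstruction is a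
sign: for a vertex decomposable complex with facets of size d, the top h-vector entry, (-1)^d times
the alternating face count, is nonnegative (`IsVertexDecomposable.alternatingSum_nonneg`). Every
vertex deletion of the complex of `G` has a facet of size 4 but a negative alternating sum, so no
vertex can be shed.

The products with complete graphs are circulant by division with remainder modulo 16, and are told
apart by their numbers of vertices. -/

/-- A pure complex is shellable as soon as its facets carry a rank with the exchange property of a
shelling, for every two distinct facets whose ranks are weakly ordered. -/
theorem isShellable_of_rank {V : Type*} [Fintype V] [DecidableEq V] {Δ : SimplicialCpx V}
    (hpure : Δ.IsPure) (r : Finset V → ℕ)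
    (hr : ∀ A B, Δ.IsFacet A → Δ.IsFacet B → A ≠ B → r B ≤ r A →
      ∃ x ∈ A \ B, ∃ C, Δ.IsFacet C ∧ r C < r A ∧ A \ C = {x}) : Δ.IsShellable := by
  classical
  refine ⟨hpure, ?_⟩
  let e := Fintype.equivFin {A // Δ.IsFacet A}
  let f : Fin (Fintype.card {A // Δ.IsFacet A}) → ℕ := fun i => r (e.symm i).1
  -- Ties in rank may be broken arbitrarily, since `hr` also covers facets of equal rank.
  let σ := Tuple.sort f
  have hmono : Monotone (f ∘ σ) := Tuple.monotone_sort f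
  refine ⟨_, fun i => (e.symm (σ i)).1, ?_, ?_, ?_⟩
  · exact Subtype.val_injective.comp (e.symm.injective.comp σ.injective)
  · ext A
    constructor
    · rintro ⟨i, rfl⟩
      exact (e.symm (σ i)).2
    · intro hA
      exact ⟨σ.symm (e ⟨A, hA⟩), by simp⟩
  · intro i j hji
    have hne : (e.symm (σ i)).1 ≠ (e.symm (σ j)).1 := fun h =>
      hji.ne' (σ.injective (e.symm.injective (Subtype.ext h)))
    obtain ⟨x, hx, C, hC, hlt, hAC⟩ :=
      hr _ _ (e.symm (σ i)).2 (e.symm (σ j)).2 hne (hmono hji.le)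
    refine ⟨x, hx, σ.symm (e ⟨C, hC⟩), ?_, by simpa using hAC⟩
    by_contra! hle
    have := hmono hle
    simp only [Function.comp, Equiv.apply_symm_apply, Equiv.symm_apply_apply, f] at this
    omega

theorem mem_deletion_singleton {V : Type*} {Δ : SimplicialCpx V} {x : V} {A : Finset V} :
    A ∈ Δ.deletion {x} ↔ A ∈ Δ ∧ x ∉ A := by
  change (A ∈ Δ ∧ ¬ {x} ⊆ A) ↔ _
  simp

theorem mem_link_singleton {V : Type*} [DecidableEq V] {Δ : SimplicialCpx V} {x : V}
    {A : Finset V} : A ∈ Δ.link {x} ↔ x ∉ A ∧ insert x A ∈ Δ := by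
  change (A ∈ Δ ∧ Disjoint {x} A ∧ {x} ∪ A ∈ Δ) ↔ _
  simp only [Finset.disjoint_singleton_left, ← Finset.insert_eq]
  exact ⟨fun h => h.2, fun h => ⟨Δ.lower (Finset.subset_insert x A) h.2, h⟩⟩

theorem exists_isFacet_superset {V : Type*} [Finite V] {Δ : SimplicialCpx V} {A : Finset V}
    (hA : A ∈ Δ) : ∃ F, A ⊆ F ∧ Δ.IsFacet F := by
  obtain ⟨F, hAF, hF⟩ := Finite.exists_le_maximal (p := fun A => A ∈ Δ) hA
  exact ⟨F, hAF, hF⟩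

open Classical in
/-- The alternating sum of the numbers of faces, which is minus the reduced Euler
characteristic. -/
noncomputable def alternatingSum {V : Type*} [Fintype V] (Δ : SimplicialCpx V) : ℤ :=
  ∑ A : Finset V with A ∈ Δ, (-1) ^ A.card

/-- Erasing `x` matches the faces containing `x` with the faces of the link and flips the sign. -/
theorem alternatingSum_eq_sub {V : Type*} [Fintype V] [DecidableEq V] (Δ : SimplicialCpx V)
    (x : V) : Δ.alternatingSum =
      (Δ.deletion {x}).alternatingSum - (Δ.link {x}).alternatingSum := by
  classical
  unfold alternatingSum
  rw [← Finset.sum_filter_add_sum_filter_not _ (fun A => x ∉ A), sub_eq_add_neg,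
    ← Finset.sum_neg_distrib]
  congr 1
  · rw [Finset.filter_filter]
    refine Finset.sum_congr ?_ fun _ _ => rfl
    ext A
    simp [mem_deletion_singleton]
  · symm
    refine Finset.sum_bij' (fun A _ => insert x A) (fun A _ => A.erase x) ?_ ?_ ?_ ?_ ?_
    · intro A hA
      simp only [Finset.mem_filter, Finset.mem_univ, true_and, mem_link_singleton] at hA ⊢
      simp [hA.2]
    · intro A hA
      simp only [Finset.mem_filter, Finset.mem_univ, true_and, mem_link_singleton, not_not]
        at hA ⊢
      simp [Finset.insert_erase hA.2, hA.1]
    · intro A hA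
      simp only [Finset.mem_filter, Finset.mem_univ, true_and, mem_link_singleton] at hA
      simp [hA.1]
    · intro A hA
      simp only [Finset.mem_filter, Finset.mem_univ, true_and, not_not] at hA
      simp [Finset.insert_erase hA.2]
    · intro A hA
      simp only [Finset.mem_filter, Finset.mem_univ, true_and, mem_link_singleton] at hA
      simp [Finset.card_insert_of_notMem hA.1, pow_succ]

/-- With purity, this makes the facets of a link exactly one smaller than those of the complex. -/
theorem IsFacet.insert_of_link {V : Type*} [DecidableEq V] {Δ : SimplicialCpx V} {x : V}
    {F : Finset V} (hF : (Δ.link {x}).IsFacet F) : Δ.IsFacet (insert x F) := by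
  have hF' := mem_link_singleton.1 hF.1
  refine ⟨hF'.2, fun B hB hle => ?_⟩
  have hxB : x ∈ B := hle (Finset.mem_insert_self x F)
  have : B.erase x ≤ F := hF.2
    (mem_link_singleton.2 ⟨Finset.notMem_erase x B, by rwa [Finset.insert_erase hxB]⟩) fun a ha =>
      Finset.mem_erase.2 ⟨fun h => hF'.1 (h ▸ ha), hle (Finset.mem_insert_of_mem ha)⟩
  intro a ha
  by_cases h : a = x
  · simp [h]
  · exact Finset.mem_insert_of_mem (this (Finset.mem_erase.2 ⟨h, ha⟩))

theorem IsFacet.deletion {V : Type*} {Δ : SimplicialCpx V} {x : V}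
    {F : Finset V} (hF : Δ.IsFacet F) (hx : x ∉ F) : (Δ.deletion {x}).IsFacet F :=
  ⟨mem_deletion_singleton.2 ⟨hF.1, hx⟩, fun _ hB => hF.2 (mem_deletion_singleton.1 hB).1⟩

/-- The top entry of the h-vector of a vertex decomposable complex is nonnegative. -/
theorem IsVertexDecomposable.alternatingSum_nonneg {V : Type*} [Fintype V] [DecidableEq V]
    {Δ : SimplicialCpx V} (h : Δ.IsVertexDecomposable) :
    ∀ F, Δ.IsFacet F → 0 ≤ (-1) ^ F.card * Δ.alternatingSum := by
  classical
  induction h with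
  | simplex Δ hpure hfacet =>
    intro F hF
    have hmem : ∀ A, A ∈ Δ ↔ A ∈ F.powerset := fun A => by
      rw [Finset.mem_powerset]
      refine ⟨fun hA => ?_, fun hA => Δ.lower hA hF.1⟩
      obtain ⟨F', hAF', hF'⟩ := exists_isFacet_superset hA
      rwa [hfacet.unique hF' hF] at hAF'
    have : Δ.alternatingSum = ∑ A ∈ F.powerset, (-1) ^ A.card :=
      Finset.sum_congr (by ext A; simpa using hmem A) fun _ _ => rfl
    rw [this, Finset.sum_powerset_neg_one_pow_card]
    split_ifs with h
    · simp [h]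
    · simp
  | shed Δ hpure x hx hdel hlink ihdel ihlink =>
    intro F hF
    rw [alternatingSum_eq_sub Δ x]
    have hxl : (∅ : Finset V) ∈ Δ.link {x} := mem_link_singleton.2 ⟨by simp, by simpa using hx⟩
    obtain ⟨L, -, hL⟩ := exists_isFacet_superset hxl
    have hcard := hpure F _ hF hL.insert_of_link
    rw [Finset.card_insert_of_notMem (mem_link_singleton.1 hL.1).1] at hcard
    -- In a cone with apex `x` the deletion has smaller facets, so its induction hypothesis carries
    -- the wrong sign; but there the deletion equals the link and the sum vanishes. Otherwise a
    -- facet avoiding `x` shows that the deletion has facets of full size.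
    by_cases hcone : ∀ F', Δ.IsFacet F' → x ∈ F'
    · have : Δ.deletion {x} = Δ.link {x} := by
        ext A
        simp only [SetLike.mem_coe, mem_deletion_singleton, mem_link_singleton, and_comm]
        refine and_congr_right fun _ => ⟨fun hA => ?_, fun hA =>
          Δ.lower (Finset.subset_insert x A) hA⟩
        obtain ⟨F', hAF', hF'⟩ := exists_isFacet_superset hA
        exact Δ.lower (Finset.insert_subset (hcone F' hF') hAF') hF'.1
      simp [this]
    · push Not at hcone
      obtain ⟨F', hF', hxF'⟩ := hcone
      have h1 := ihdel F' (hF'.deletion hxF')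
      have h2 := ihlink L hL
      rw [hpure F' F hF' hF] at h1
      rw [hcard, pow_succ] at h1 ⊢
      linarith

end SimplicialCpx

/-! ### Blowups: descent of vertex decomposability and lifting of shellings -/

namespace SimplicialCpx

/-- The blowup of a complex along `π`, on the vertices in `W`: the sets of vertices on which `π`
is injective and whose image is a face. -/
def blowup {V V' : Type*} [DecidableEq V] (π : V' → V) (Γ : SimplicialCpx V) (W : Set V') :
    SimplicialCpx V' where
  carrier := {A | (A : Set V') ⊆ W ∧ Set.InjOn π A ∧ A.image π ∈ Γ}
  lower' := fun _ _ hle hA => ⟨(Finset.coe_subset.2 hle).trans hA.1,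
    hA.2.1.mono (Finset.coe_subset.2 hle), Γ.lower (Finset.image_subset_image hle) hA.2.2⟩

/-- The faces contained in `U`. -/
def restrict {V : Type*} (Γ : SimplicialCpx V) (U : Set V) : SimplicialCpx V where
  carrier := {A | A ∈ Γ ∧ (A : Set V) ⊆ U}
  lower' := fun _ _ hle hA => ⟨Γ.lower hle hA.1, (Finset.coe_subset.2 hle).trans hA.2⟩

section

variable {V V' : Type*} [DecidableEq V] {π : V' → V} {Γ : SimplicialCpx V} {W : Set V'}

theorem mem_blowup {A : Finset V'} :
    A ∈ blowup π Γ W ↔ (A : Set V') ⊆ W ∧ Set.InjOn π A ∧ A.image π ∈ Γ := Iff.rfl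

omit [DecidableEq V] in
theorem mem_restrict {U : Set V} {A : Finset V} :
    A ∈ Γ.restrict U ↔ A ∈ Γ ∧ (A : Set V) ⊆ U := Iff.rfl

omit [DecidableEq V] in
theorem restrict_univ : Γ.restrict Set.univ = Γ := by
  ext A
  simp [mem_restrict]

theorem image_mem_restrict {A : Finset V'} (hA : A ∈ blowup π Γ W) :
    A.image π ∈ Γ.restrict (π '' W) :=
  ⟨hA.2.2, by rw [Finset.coe_image]; exact Set.image_mono hA.1⟩

/-- A face that contains the image of a face of the blowup lifts to a larger face. -/
theorem exists_lift [DecidableEq V'] {A : Finset V'} {F : Finset V} (hA : A ∈ blowup π Γ W)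
    (hF : F ∈ Γ.restrict (π '' W)) (hAF : A.image π ⊆ F) :
    ∃ B ∈ blowup π Γ W, A ⊆ B ∧ B.image π = F := by
  obtain ⟨C, hC, hCF, hinj⟩ := Finset.exists_subset_injOn_image_eq_of_surjOn W
    (F \ A.image π) (f := π) (fun v hv => hF.2 (by
      have := Finset.mem_coe.1 hv
      exact (Finset.mem_sdiff.1 this).1))
  have hCm : ∀ c ∈ C, π c ∈ F ∧ π c ∉ A.image π := fun c hc => by
    have := Finset.mem_image_of_mem π hc
    rw [hinj] at this
    exact Finset.mem_sdiff.1 this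
  have himg : (A ∪ C).image π = F := by
    rw [Finset.image_union, hinj, Finset.union_sdiff_of_subset hAF]
  refine ⟨A ∪ C, ⟨?_, ?_, himg ▸ hF.1⟩, Finset.subset_union_left, himg⟩
  · rw [Finset.coe_union]
    exact Set.union_subset hA.1 hC
  · intro a ha b hb hab
    rcases Finset.mem_union.1 (Finset.mem_coe.1 ha) with ha | ha <;>
      rcases Finset.mem_union.1 (Finset.mem_coe.1 hb) with hb | hb
    · exact hA.2.1 ha hb hab
    · exact absurd (hab ▸ Finset.mem_image_of_mem π ha) (hCm b hb).2
    · exact absurd (hab ▸ Finset.mem_image_of_mem π hb) (hCm a ha).2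
    · exact hCF ha hb hab

theorem exists_lift_eq [DecidableEq V'] {F : Finset V} (hF : F ∈ Γ.restrict (π '' W)) :
    ∃ B ∈ blowup π Γ W, B.image π = F := by
  obtain ⟨B, hB, -, hBF⟩ := exists_lift (A := ∅) ⟨by simp, by simp, Γ.lower (by simp) hF.1⟩ hF
    (by simp)
  exact ⟨B, hB, hBF⟩

theorem card_image_of_mem_blowup {A : Finset V'} (hA : A ∈ blowup π Γ W) :
    (A.image π).card = A.card := Finset.card_image_of_injOn hA.2.1

/-- Faces above the image lift, and images preserve cardinality. The restriction to `π '' W` is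
needed because `W` may miss entire fibres. -/
theorem isFacet_blowup_iff [DecidableEq V'] {A : Finset V'} (hA : A ∈ blowup π Γ W) :
    (blowup π Γ W).IsFacet A ↔ (Γ.restrict (π '' W)).IsFacet (A.image π) := by
  constructor
  · intro h
    refine ⟨image_mem_restrict hA, fun F hF hle => ?_⟩
    obtain ⟨B, hB, hAB, rfl⟩ := exists_lift hA hF hle
    exact Finset.image_subset_image (h.2 hB hAB)
  · intro h
    refine ⟨hA, fun B hB hle => ?_⟩
    have h1 := Finset.card_le_card (h.2 (image_mem_restrict hB) (Finset.image_subset_image hle))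
    rw [card_image_of_mem_blowup hA, card_image_of_mem_blowup hB] at h1
    exact (Finset.eq_of_subset_of_card_le hle h1).ge

theorem isPure_blowup_iff [DecidableEq V'] :
    (blowup π Γ W).IsPure ↔ (Γ.restrict (π '' W)).IsPure := by
  constructor
  · intro h F F' hF hF'
    obtain ⟨A, hA, rfl⟩ := exists_lift_eq hF.1
    obtain ⟨A', hA', rfl⟩ := exists_lift_eq hF'.1
    rw [card_image_of_mem_blowup hA, card_image_of_mem_blowup hA']
    exact h _ _ ((isFacet_blowup_iff hA).2 hF) ((isFacet_blowup_iff hA').2 hF')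
  · intro h A A' hA hA'
    rw [← card_image_of_mem_blowup hA.1, ← card_image_of_mem_blowup hA'.1]
    exact h _ _ ((isFacet_blowup_iff hA.1).1 hA) ((isFacet_blowup_iff hA'.1).1 hA')

/-- Deletions shrink `W` while links change `Γ`; carrying both parameters keeps blowups closed under
the two operations of the recursion. -/
theorem deletion_blowup (x : V') :
    (blowup π Γ W).deletion {x} = blowup π Γ (W \ {x}) := by
  ext A
  simp only [SetLike.mem_coe, mem_deletion_singleton, mem_blowup, Set.subset_sdiff,
    Set.disjoint_singleton_right]
  tauto

/-- `W` need not shrink: `π x` is not a vertex of the link of `π x`, so no copy of it lies in a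
face. -/
theorem link_blowup [DecidableEq V'] {x : V'} (hx : x ∈ W) :
    (blowup π Γ W).link {x} = blowup π (Γ.link {π x}) W := by
  ext A
  simp only [SetLike.mem_coe, mem_link_singleton, mem_blowup, Finset.coe_insert,
    Set.insert_subset_iff, Finset.image_insert, hx, true_and]
  constructor
  · rintro ⟨hxA, hA, hinj, hmem⟩
    rw [Set.injOn_insert (by simpa using hxA)] at hinj
    exact ⟨hA, hinj.1, by simpa using hinj.2, hmem⟩
  · rintro ⟨hA, hinj, hxA, hmem⟩
    have : x ∉ A := fun h => hxA (Finset.mem_image_of_mem π h)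
    refine ⟨this, hA, ?_, hmem⟩
    rw [Set.injOn_insert (by simpa using this)]
    exact ⟨hinj, by simpa using hxA⟩

omit [DecidableEq V] in
theorem deletion_restrict (U : Set V) (v : V) :
    (Γ.restrict U).deletion {v} = Γ.restrict (U \ {v}) := by
  ext A
  simp only [SetLike.mem_coe, mem_deletion_singleton, mem_restrict, Set.subset_sdiff,
    Set.disjoint_singleton_right, and_assoc]

theorem link_restrict {U : Set V} {v : V} (hv : v ∈ U) :
    (Γ.restrict U).link {v} = (Γ.link {v}).restrict U := by
  ext A
  simp only [SetLike.mem_coe, mem_link_singleton, mem_restrict, Finset.coe_insert,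
    Set.insert_subset_iff, hv, true_and, and_assoc]

/-- Vertex decomposability descends from a blowup. -/
theorem IsVertexDecomposable.of_blowup [DecidableEq V']
    (h : (blowup π Γ W).IsVertexDecomposable) :
    (Γ.restrict (π '' W)).IsVertexDecomposable := by
  generalize hΔ : blowup π Γ W = Δ at h
  induction h generalizing Γ W with
  | simplex Δ hpure hfacet =>
    subst hΔ
    refine .simplex _ (isPure_blowup_iff.1 hpure) ?_
    obtain ⟨A, hA, huniq⟩ := hfacet
    refine ⟨A.image π, (isFacet_blowup_iff hA.1).1 hA, fun F hF => ?_⟩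
    obtain ⟨B, hB, rfl⟩ := exists_lift_eq hF.1
    rw [huniq B ((isFacet_blowup_iff hB).2 hF)]
  | shed Δ hpure x hx hdel hlink ihdel ihlink =>
    subst hΔ
    have hxW : x ∈ W := hx.1 (by simp)
    have hdel' := ihdel (deletion_blowup x).symm
    have hlink' := ihlink (link_blowup hxW).symm
    -- If another copy of `π x` remains, the deletion already projects to the whole complex and its
    -- decomposability suffices. Otherwise `π x` itself is the vertex to shed.
    by_cases hfib : π x ∈ π '' (W \ {x})
    · have : π '' (W \ {x}) = π '' W := by
        refine (Set.image_mono Set.sdiff_subset).antisymm ?_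
        rintro _ ⟨y, hy, rfl⟩
        by_cases hyx : y = x
        · rwa [hyx]
        · exact ⟨y, ⟨hy, hyx⟩, rfl⟩
      rwa [this] at hdel'
    · have : π '' (W \ {x}) = π '' W \ {π x} := by
        ext v
        constructor
        · rintro ⟨y, hy, rfl⟩
          exact ⟨⟨y, hy.1, rfl⟩, fun h => hfib (h ▸ ⟨y, hy, rfl⟩)⟩
        · rintro ⟨⟨y, hy, rfl⟩, hne⟩
          exact ⟨y, ⟨hy, fun h => hne (by rw [Set.mem_singleton_iff.1 h]; rfl)⟩, rfl⟩
      have hxπ : π x ∈ π '' W := ⟨x, hxW, rfl⟩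
      refine .shed _ (isPure_blowup_iff.1 hpure) (π x) ?_ ?_ ?_
      · simpa using image_mem_restrict hx
      · rwa [deletion_restrict, ← this]
      · rwa [link_restrict hxπ]

/-- A ranked shelling lifts to a blowup along a surjection. -/
theorem isShellable_blowup [Fintype V'] [DecidableEq V'] (hπ : Function.Surjective π)
    (hpure : Γ.IsPure) (r : Finset V → ℕ)
    (hr : ∀ A B, Γ.IsFacet A → Γ.IsFacet B → A ≠ B → r B ≤ r A →
      ∃ x ∈ A \ B, ∃ C, Γ.IsFacet C ∧ r C < r A ∧ A \ C = {x}) :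
    (blowup π Γ Set.univ).IsShellable := by
  have hΓ : Γ.restrict (π '' Set.univ) = Γ := by rw [Set.image_univ_of_surjective hπ, restrict_univ]
  let idx : V' → ℕ := fun a => Fintype.equivFin V' a
  have hidx : Function.Injective idx := Fin.val_injective.comp (Fintype.equivFin V').injective
  -- `M` strictly exceeds every partial sum of indices, so the rank below compares image ranks first
  -- and index sums second.
  let M := ∑ a, idx a + 1
  have hM : ∀ A : Finset V', ∑ a ∈ A, idx a < M := fun A =>
    Nat.lt_succ_of_le (Finset.sum_le_sum_of_subset (Finset.subset_univ A))
  have hfacet : ∀ A, (blowup π Γ Set.univ).IsFacet A → Γ.IsFacet (A.image π) := fun A hA => by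
    have := (isFacet_blowup_iff hA.1).1 hA
    rwa [hΓ] at this
  have hfacet' : ∀ A ∈ blowup π Γ Set.univ, Γ.IsFacet (A.image π) →
      (blowup π Γ Set.univ).IsFacet A := fun A hA h => by
    rw [isFacet_blowup_iff hA, hΓ]
    exact h
  refine isShellable_of_rank (isPure_blowup_iff.2 (hΓ.symm ▸ hpure))
    (fun A => r (A.image π) * M + ∑ a ∈ A, idx a) fun A B hA hB hne hle => ?_
  have hlex : ∀ C : Finset V', r (C.image π) < r (A.image π) →
      r (C.image π) * M + ∑ a ∈ C, idx a < r (A.image π) * M + ∑ a ∈ A, idx a := fun C hC => by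
    have := Nat.mul_le_mul_right M (Nat.succ_le_of_lt hC)
    have := hM C
    rw [Nat.succ_mul] at *
    omega
  by_cases hAB : A.image π = B.image π
  · have hsum : ∑ a ∈ B, idx a ≤ ∑ a ∈ A, idx a := by
      simp only [hAB] at hle
      omega
    -- Facets with the same image differ only in the choice of copies. If no copy in `B` had a
    -- smaller index than its partner in `A`, the inequality of sums would force equality
    -- throughout, hence `A = B`. Trading `a` for `b` then lowers the rank and leaves the image
    -- fixed.
    have hex : ∃ a ∈ A, ∃ b ∈ B, π a = π b ∧ idx b < idx a := by
      by_contra! hcon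
      have hg : ∀ a : V', ∃ b, a ∈ A → b ∈ B ∧ π b = π a := fun a => by
        by_cases ha : a ∈ A
        · have := Finset.mem_image_of_mem π ha
          rw [hAB, Finset.mem_image] at this
          obtain ⟨b, hb, hba⟩ := this
          exact ⟨b, fun _ => ⟨hb, hba⟩⟩
        · exact ⟨a, fun h => absurd h ha⟩
      choose g hg using hg
      have hginj : Set.InjOn g A := fun a ha a' ha' h => hA.1.2.1 ha ha' (by
        rw [← (hg a ha).2, ← (hg a' ha').2, h])
      have hcard : A.card = B.card := by
        rw [← card_image_of_mem_blowup hA.1, ← card_image_of_mem_blowup hB.1, hAB]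
      have himg : A.image g = B := by
        refine Finset.eq_of_subset_of_card_le (fun b hb => ?_) ?_
        · obtain ⟨a, ha, rfl⟩ := Finset.mem_image.1 hb
          exact (hg a ha).1
        · rw [Finset.card_image_of_injOn hginj, hcard]
      have hsum' : ∑ a ∈ A, idx (g a) = ∑ b ∈ B, idx b := by
        rw [← himg, Finset.sum_image hginj]
      have hpt : ∀ a ∈ A, idx a ≤ idx (g a) := fun a ha =>
        hcon a ha (g a) (hg a ha).1 (hg a ha).2.symm
      have heq := (Finset.sum_eq_sum_iff_of_le hpt).1
        (le_antisymm (Finset.sum_le_sum hpt) (hsum'.trans_le hsum))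
      refine hne ?_
      rw [← himg]
      ext b
      rw [Finset.mem_image]
      constructor
      · exact fun hb => ⟨b, hb, (hidx (heq b hb)).symm⟩
      · rintro ⟨a, ha, rfl⟩
        rwa [← hidx (heq a ha)]
    obtain ⟨a, ha, b, hb, hab, hlt⟩ := hex
    have hne' : b ≠ a := by rintro rfl; exact hlt.false
    have haB : a ∉ B := fun h => hne' (hB.1.2.1 hb h hab.symm)
    have hbA : b ∉ A := fun h => hne' (hA.1.2.1 h ha hab.symm)
    have himg : (insert b (A.erase a)).image π = A.image π := by
      rw [Finset.image_insert, ← hab, ← Finset.image_insert, Finset.insert_erase ha]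
    have hC : insert b (A.erase a) ∈ blowup π Γ Set.univ := by
      refine ⟨Set.subset_univ _, ?_, himg ▸ hA.1.2.2⟩
      rw [Finset.coe_insert, Set.injOn_insert (by simp [hbA])]
      refine ⟨hA.1.2.1.mono (by simp), ?_⟩
      rintro ⟨c, hc, hcb⟩
      have hc := Finset.mem_erase.1 (Finset.mem_coe.1 hc)
      exact hc.1 (hA.1.2.1 hc.2 ha (hcb.trans hab.symm))
    refine ⟨a, by simp [ha, haB], _, hfacet' _ hC (himg ▸ hfacet A hA), ?_, ?_⟩
    · simp only [himg]
      rw [Finset.sum_insert (by simp [hbA]), ← Finset.add_sum_erase A idx ha]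
      omega
    · ext c
      simp only [Finset.mem_sdiff, Finset.mem_insert, Finset.mem_erase, Finset.mem_singleton]
      constructor
      · tauto
      · rintro rfl
        exact ⟨ha, fun h => h.elim (fun h => hne' h.symm) fun h => h.1 rfl⟩
  · have hrle : r (B.image π) ≤ r (A.image π) := by
      by_contra! hlt
      have := Nat.mul_le_mul_right M (Nat.succ_le_of_lt hlt)
      have := hM A
      rw [Nat.succ_mul] at *
      omega
    -- The images differ: exchange below, then lift `C` so as to keep every vertex of `A` other than
    -- `a`.
    obtain ⟨x, hx, C, hC, hlt, hAC⟩ := hr _ _ (hfacet A hA) (hfacet B hB) hAB hrle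
    rw [Finset.mem_sdiff, Finset.mem_image] at hx
    obtain ⟨⟨a, ha, rfl⟩, haB⟩ := hx
    have haC : π a ∉ C := by
      have : π a ∈ A.image π \ C := by simp [hAC]
      exact (Finset.mem_sdiff.1 this).2
    have hsub : (A.erase a).image π ⊆ C := by
      intro v hv
      obtain ⟨c, hc, rfl⟩ := Finset.mem_image.1 hv
      rw [Finset.mem_erase] at hc
      by_contra hcC
      have : π c ∈ A.image π \ C :=
        Finset.mem_sdiff.2 ⟨Finset.mem_image_of_mem π hc.2, hcC⟩
      rw [hAC, Finset.mem_singleton] at this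
      exact hc.1 (hA.1.2.1 hc.2 ha this)
    obtain ⟨C', hC', hsub', himg⟩ := exists_lift
      ((blowup π Γ Set.univ).lower (Finset.erase_subset a A) hA.1) (hΓ.symm ▸ hC.1) hsub
    have haC' : a ∉ C' := fun h => haC (himg ▸ Finset.mem_image_of_mem π h)
    refine ⟨a, Finset.mem_sdiff.2 ⟨ha, fun h => haB (Finset.mem_image_of_mem π h)⟩, C',
      hfacet' _ hC' (himg ▸ hC), hlex C' (himg ▸ hlt), ?_⟩
    ext c
    rw [Finset.mem_sdiff, Finset.mem_singleton]
    constructor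
    · rintro ⟨hcA, hcC⟩
      by_contra hne
      exact hcC (hsub' (Finset.mem_erase.2 ⟨hne, hcA⟩))
    · rintro rfl
      exact ⟨ha, haC'⟩

end

end SimplicialCpx

/-! ### Independence complexes under replacement of vertices by cliques -/

namespace SimpleGraph

theorem mem_indComplex {V : Type*} {G : SimpleGraph V} {A : Finset V} :
    A ∈ G.indComplex ↔ G.IsIndepSet (A : Set V) := Iff.rfl

/-- Replacing vertices by cliques blows up the independence complex. -/
theorem indComplex_eq_blowup {V V' : Type*} [DecidableEq V] {G : SimpleGraph V}
    {G' : SimpleGraph V'} {π : V' → V}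
    (h : ∀ p q, G'.Adj p q ↔ p ≠ q ∧ (G.Adj (π p) (π q) ∨ π p = π q)) :
    G'.indComplex = SimplicialCpx.blowup π G.indComplex Set.univ := by
  ext A
  simp only [SetLike.mem_coe, SimplicialCpx.mem_blowup, mem_indComplex, Set.subset_univ, true_and,
    Finset.coe_image]
  constructor
  · intro hA
    refine ⟨fun a ha b hb hab => ?_, ?_⟩
    · by_contra hne
      exact hA ha hb hne ((h a b).2 ⟨hne, .inr hab⟩)
    · rintro _ ⟨a, ha, rfl⟩ _ ⟨b, hb, rfl⟩ hne hadj
      have hab : a ≠ b := fun h => hne (h ▸ rfl)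
      exact hA ha hb hab ((h a b).2 ⟨hab, .inl hadj⟩)
  · rintro ⟨hinj, hA⟩ a ha b hb hne hadj
    have hπ : π a ≠ π b := fun h => hne (hinj ha hb h)
    exact hA ⟨a, ha, rfl⟩ ⟨b, hb, rfl⟩ hπ (((h a b).1 hadj).2.resolve_right hπ)

end SimpleGraph

/-! ### Computations for the 16-vertex circulant graph -/

namespace SimpleGraph

/-- The sublists of a list whose entries are pairwise nonadjacent. -/
def indepLists {V : Type*} (adj : V → V → Bool) : List V → List (List V)
  | [] => [[]]
  | v :: l => indepLists adj l ++
      ((indepLists adj l).filter fun A => A.all fun w => !adj v w).map (v :: ·)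

theorem mem_indepLists {V : Type*} {adj : V → V → Bool} {l A : List V} :
    A ∈ indepLists adj l ↔ A.Sublist l ∧ A.Pairwise fun v w => adj v w = false := by
  induction l generalizing A with
  | nil =>
    simp only [indepLists, List.mem_singleton, List.sublist_nil]
    exact ⟨fun h => ⟨h, h ▸ .nil⟩, fun h => h.1⟩
  | cons v l ih =>
    simp only [indepLists, List.mem_append, List.mem_map, List.mem_filter, ih,
      List.sublist_cons_iff, List.all_eq_true, Bool.not_eq_true']
    constructor
    · rintro (h | ⟨B, ⟨⟨h1, h2⟩, h3⟩, rfl⟩)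
      · exact ⟨.inl h.1, h.2⟩
      · exact ⟨.inr ⟨B, rfl, h1⟩, List.pairwise_cons.2 ⟨h3, h2⟩⟩
    · rintro ⟨h | ⟨B, rfl, h1⟩, h2⟩
      · exact .inl ⟨h, h2⟩
      · rw [List.pairwise_cons] at h2
        exact .inr ⟨B, ⟨⟨h1, h2.2⟩, h2.1⟩, rfl⟩

theorem nodup_indepLists {V : Type*} {adj : V → V → Bool} {l : List V} (hl : l.Nodup) :
    (indepLists adj l).Nodup := by
  induction l with
  | nil => simp [indepLists]
  | cons v l ih =>
    rw [List.nodup_cons] at hl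
    refine List.Nodup.append (ih hl.2)
      (((ih hl.2).filter _).map (List.cons_injective (a := v))) fun A hA hA' => ?_
    obtain ⟨B, -, rfl⟩ := List.mem_map.1 hA'
    exact hl.1 ((mem_indepLists.1 hA).1.subset (by simp))

/-- Makes `List.toFinset` injective on the sublists of a duplicate-free list, so that sums over
faces become sums over lists. -/
theorem _root_.List.Sublist.filter_mem_toFinset {V : Type*} [DecidableEq V] {A l : List V}
    (h : A.Sublist l) (hl : l.Nodup) : l.filter (· ∈ A.toFinset) = A := by
  induction h with
  | slnil => rfl
  | @cons A l v h ih =>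
    rw [List.nodup_cons] at hl
    have : v ∉ A := fun hv => hl.1 (h.subset hv)
    rw [List.filter_cons_of_neg (by simpa using this), ih hl.2]
  | @cons_cons A l v h ih =>
    rw [List.nodup_cons] at hl
    rw [List.filter_cons_of_pos (by simp)]
    congr 1
    refine Eq.trans (List.filter_congr fun w hw => ?_) (ih hl.2)
    have : w ≠ v := fun h => hl.1 (h ▸ hw)
    simp [this]

theorem mem_indComplex_iff_exists_indepLists {V : Type*} [DecidableEq V] {G : SimpleGraph V}
    {adj : V → V → Bool} (hadj : ∀ v w, G.Adj v w ↔ adj v w = true) {l : List V} (hl : l.Nodup)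
    {A : Finset V} :
    (A ∈ G.indComplex ∧ ∀ v ∈ A, v ∈ l) ↔ ∃ L ∈ indepLists adj l, L.toFinset = A := by
  have hpw : ∀ v w, adj v w = false ↔ ¬ G.Adj v w := by simp [hadj]
  have hsymm : Std.Symm fun v w => ¬ G.Adj v w := ⟨fun v w h h' => h h'.symm⟩
  simp only [mem_indepLists, hpw]
  constructor
  · rintro ⟨hA, hAl⟩
    have hf : (l.filter (· ∈ A)).toFinset = A := by
      ext v
      simpa using hAl v
    refine ⟨l.filter (· ∈ A), ⟨List.filter_sublist, ?_⟩, hf⟩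
    refine List.Nodup.pairwise_of_forall_ne (hl.filter _) fun v hv w hw hne => ?_
    exact hA (by simpa using (List.mem_filter.1 hv).2) (by simpa using (List.mem_filter.1 hw).2) hne
  · rintro ⟨L, ⟨hL, hLp⟩, rfl⟩
    refine ⟨?_, fun v hv => hL.subset (by simpa using hv)⟩
    intro v hv w hw hne
    exact hLp.forall (by simpa using hv) (by simpa using hw) hne

/-- Makes the alternating sum computable by the kernel; dropping a vertex from `l` computes the
deletion. -/
theorem alternatingSum_eq_indepLists {V : Type*} [Fintype V] [DecidableEq V] {G : SimpleGraph V}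
    {adj : V → V → Bool} (hadj : ∀ v w, G.Adj v w ↔ adj v w = true) {l : List V} (hl : l.Nodup)
    {Δ : SimplicialCpx V} (hΔ : ∀ A, A ∈ Δ ↔ A ∈ G.indComplex ∧ ∀ v ∈ A, v ∈ l) :
    Δ.alternatingSum = ((indepLists adj l).map fun L => (-1) ^ L.length).sum := by
  classical
  have hinj : ∀ L ∈ indepLists adj l, ∀ L' ∈ indepLists adj l, L.toFinset = L'.toFinset → L = L' :=
    fun L hL L' hL' h => by
      rw [← (mem_indepLists.1 hL).1.filter_mem_toFinset hl, h,
        (mem_indepLists.1 hL').1.filter_mem_toFinset hl]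
  have hnd : ((indepLists adj l).map List.toFinset).Nodup :=
    (nodup_indepLists hl).map_on hinj
  have : (Finset.univ.filter (· ∈ Δ)) = ((indepLists adj l).map List.toFinset).toFinset := by
    ext A
    simp only [Finset.mem_filter, Finset.mem_univ, true_and, List.mem_toFinset, List.mem_map]
    rw [hΔ, mem_indComplex_iff_exists_indepLists hadj hl]
  rw [SimplicialCpx.alternatingSum, this, List.sum_toFinset _ hnd, List.map_map]
  congr 1
  refine List.map_congr_left fun L hL => ?_
  rw [Function.comp, List.toFinset_card_of_nodup ((mem_indepLists.1 hL).1.nodup hl)]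

theorem isFacet_indComplex_iff {V : Type*} [DecidableEq V] {G : SimpleGraph V} {A : Finset V} :
    G.indComplex.IsFacet A ↔ A ∈ G.indComplex ∧ ∀ v ∉ A, ∃ w ∈ A, G.Adj v w := by
  constructor
  · intro h
    refine ⟨h.1, fun v hv => ?_⟩
    by_contra! hcon
    refine hv (h.2 (y := insert v A) ?_ (Finset.subset_insert v A) (Finset.mem_insert_self v A))
    change G.IsIndepSet _
    rw [Finset.coe_insert]
    exact h.1.insert fun w hw hne => ⟨hcon w hw, fun h => hcon w hw h.symm⟩
  · rintro ⟨hA, h⟩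
    refine ⟨hA, fun B hB hle v hv => ?_⟩
    by_contra hvA
    obtain ⟨w, hw, hvw⟩ := h v hvA
    exact hB hv (hle hw) hvw.ne hvw

/-- Adjacency in `C₁₆(1, 4, 8)`. -/
def adj16 (a b : ZMod 16) : Bool := decide (a - b ∈ ([1, 4, 8, 12, 15] : List (ZMod 16)))

/-- Modulo 16, the residues 15 and 12 are the negatives of 1 and 4, and 8 is its own negative. -/
theorem circulant16_adj (a b : ZMod 16) :
    (circulant 16 {1, 4, 8}).Adj a b ↔ adj16 a b = true := by
  simp only [circulant, circulantGraph_adj, Set.image_insert_eq, Set.image_singleton,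
    Set.mem_insert_iff, Set.mem_singleton_iff]
  revert a b
  decide +kernel

/-- The vertices of `C₁₆(1, 4, 8)`. -/
def verts16 : List (ZMod 16) := List.finRange 16

theorem nodup_verts16 : verts16.Nodup := List.nodup_finRange 16

theorem mem_verts16 (v : ZMod 16) : v ∈ verts16 := List.mem_finRange (n := 16) v

/-- A shelling of the independence complex of `C₁₆(1, 4, 8)`. -/
def shelling16 : List (List (ZMod 16)) := [
  [0, 2, 5, 7], [0, 2, 5, 11], [0, 2, 7, 9], [0, 2, 7, 13], [0, 2, 9, 11],
  [0, 2, 11, 13], [0, 5, 7, 10], [0, 3, 5, 10], [0, 3, 5, 14], [0, 5, 7, 14],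
  [0, 5, 11, 14], [0, 6, 9, 11], [0, 6, 11, 13], [0, 7, 9, 14], [0, 3, 9, 14],
  [0, 3, 6, 9], [0, 3, 6, 13], [0, 3, 10, 13], [0, 7, 10, 13], [0, 9, 11, 14],
  [2, 4, 7, 9], [2, 4, 7, 13], [2, 4, 9, 11], [2, 4, 9, 15], [2, 4, 11, 13],
  [2, 4, 13, 15], [2, 5, 7, 12], [2, 5, 8, 11], [2, 7, 9, 12], [2, 8, 11, 13],
  [2, 8, 13, 15], [2, 5, 8, 15], [2, 5, 12, 15], [2, 9, 12, 15], [4, 6, 9, 11],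
  [1, 4, 6, 11], [4, 6, 9, 15], [1, 4, 6, 15], [4, 6, 11, 13], [4, 6, 13, 15],
  [4, 7, 9, 14], [4, 7, 10, 13], [4, 9, 11, 14], [1, 4, 11, 14], [1, 4, 7, 14],
  [1, 4, 7, 10], [1, 4, 10, 15], [4, 10, 13, 15], [5, 7, 10, 12], [1, 7, 10, 12],
  [1, 7, 12, 14], [3, 5, 10, 12], [1, 3, 10, 12], [5, 7, 12, 14], [3, 5, 12, 14],
  [1, 3, 12, 14], [5, 8, 11, 14], [1, 8, 11, 14], [1, 3, 8, 14], [1, 3, 8, 10],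
  [1, 6, 8, 11], [3, 5, 8, 14], [3, 5, 8, 10], [6, 8, 11, 13], [6, 8, 13, 15],
  [1, 6, 8, 15], [1, 8, 10, 15], [5, 8, 10, 15], [5, 10, 12, 15], [1, 10, 12, 15],
  [1, 6, 12, 15], [6, 9, 12, 15], [7, 9, 12, 14], [3, 9, 12, 14], [3, 6, 9, 12],
  [1, 3, 6, 12], [1, 3, 6, 8], [3, 6, 8, 13], [3, 8, 10, 13], [8, 10, 13, 15]]

theorem mem_shelling16_of_indepLists : ∀ A ∈ indepLists adj16 verts16,
    (∀ v ∈ verts16, v ∉ A → ∃ w ∈ A, adj16 v w = true) → A ∈ shelling16 := by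
  decide +kernel

theorem shelling16_maximal : ∀ A ∈ shelling16, A ∈ indepLists adj16 verts16 ∧ A.length = 4 ∧
    ∀ v ∈ verts16, v ∉ A → ∃ w ∈ A, adj16 v w = true := by
  decide +kernel

theorem shelling16_exchange : ∀ i (hi : i < shelling16.length), ∀ B ∈ shelling16.take i,
    ∃ x ∈ shelling16[i], x ∉ B ∧ ∃ C ∈ shelling16.take i, shelling16[i].filter (· ∉ C) = [x] := by
  decide +kernel

/-- The numerical obstruction: with facets of even size 4, a vertex decomposable deletion would need
a nonnegative sum. -/
theorem alternatingSum_neg : ∀ v : ZMod 16,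
    ((indepLists adj16 (verts16.filter (· ≠ v))).map fun A => (-1 : ℤ) ^ A.length).sum < 0 := by
  decide +kernel

theorem isFacet_circulant16_iff {A : Finset (ZMod 16)} :
    (circulant 16 {1, 4, 8}).indComplex.IsFacet A ↔ ∃ L ∈ shelling16, L.toFinset = A := by
  have hmem : A ∈ (circulant 16 {1, 4, 8}).indComplex ↔
      ∃ L ∈ indepLists adj16 verts16, L.toFinset = A := by
    rw [← mem_indComplex_iff_exists_indepLists circulant16_adj nodup_verts16]
    simp [mem_verts16]
  rw [isFacet_indComplex_iff, hmem]
  simp only [circulant16_adj]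
  constructor
  · rintro ⟨⟨L, hL, rfl⟩, h⟩
    exact ⟨L, mem_shelling16_of_indepLists L hL fun v _ hv => by simpa using h v (by simpa), rfl⟩
  · rintro ⟨L, hL, rfl⟩
    obtain ⟨h1, -, h2⟩ := shelling16_maximal L hL
    exact ⟨⟨L, h1, rfl⟩, fun v hv => by simpa using h2 v (mem_verts16 v) (by simpa using hv)⟩

theorem card_of_isFacet_circulant16 {A : Finset (ZMod 16)}
    (hA : (circulant 16 {1, 4, 8}).indComplex.IsFacet A) : A.card = 4 := by
  obtain ⟨L, hL, rfl⟩ := isFacet_circulant16_iff.1 hA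
  obtain ⟨h1, h2, -⟩ := shelling16_maximal L hL
  rw [List.toFinset_card_of_nodup ((mem_indepLists.1 h1).1.nodup nodup_verts16), h2]

/-- The rank of a facet is its position in `shelling16`, which puts the checked shelling in the form
required for lifting to blowups. -/
theorem circulant16_exchange (A B : Finset (ZMod 16))
    (hA : (circulant 16 {1, 4, 8}).indComplex.IsFacet A)
    (hB : (circulant 16 {1, 4, 8}).indComplex.IsFacet B) (hne : A ≠ B)
    (hle : (shelling16.map List.toFinset).idxOf B ≤ (shelling16.map List.toFinset).idxOf A) :
    ∃ x ∈ A \ B, ∃ C, (circulant 16 {1, 4, 8}).indComplex.IsFacet C ∧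
      (shelling16.map List.toFinset).idxOf C < (shelling16.map List.toFinset).idxOf A ∧
      A \ C = {x} := by
  rw [isFacet_circulant16_iff, ← List.mem_map] at hA hB
  have hAi := List.idxOf_lt_length_iff.2 hA
  have hBi := List.idxOf_lt_length_iff.2 hB
  have hA' := List.getElem_idxOf hAi
  have hB' := List.getElem_idxOf hBi
  have hlt : (shelling16.map List.toFinset).idxOf B < (shelling16.map List.toFinset).idxOf A := by
    refine lt_of_le_of_ne hle fun h => hne ?_
    rw [← hA', ← hB']
    congr 1
    exact h.symm
  generalize (shelling16.map List.toFinset).idxOf A = i at *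
  generalize (shelling16.map List.toFinset).idxOf B = j at *
  rw [List.length_map] at hAi hBi
  rw [List.getElem_map] at hA' hB'
  obtain ⟨x, hx, hxB, C, hC, hAC⟩ := shelling16_exchange i hAi shelling16[j]
    (List.mem_take_iff_getElem.2 ⟨j, by omega, rfl⟩)
  refine ⟨x, by simpa [← hA', ← hB'] using ⟨hx, hxB⟩, C.toFinset,
    isFacet_circulant16_iff.2 ⟨C, List.mem_of_mem_take hC, rfl⟩, ?_, ?_⟩
  · obtain ⟨k, hk, rfl⟩ := List.mem_take_iff_getElem.1 hC
    -- `idxOf` returns the first occurrence, so the index of `C` is at most the position `k < i`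
    -- where it was found.
    refine lt_of_le_of_lt ?_ (lt_of_lt_of_le hk (min_le_left _ _))
    by_contra! hcon
    have := List.not_of_lt_findIdx hcon
    simp at this
  · rw [← hA']
    have : (shelling16[i].filter (· ∉ C)).toFinset = {x} := by rw [hAC]; simp
    rw [← this]
    ext v
    simp

theorem isPure_circulant16 : (circulant 16 {1, 4, 8}).indComplex.IsPure := fun F F' hF hF' => by
  rw [card_of_isFacet_circulant16 hF, card_of_isFacet_circulant16 hF']

theorem isShellable_of_cliques {V : Type*} [Fintype V] [DecidableEq V] {G : SimpleGraph V}
    {π : V → ZMod 16} (hπ : Function.Surjective π) (h : ∀ p q, G.Adj p q ↔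
      p ≠ q ∧ ((circulant 16 {1, 4, 8}).Adj (π p) (π q) ∨ π p = π q)) : G.IsShellable := by
  rw [IsShellable, indComplex_eq_blowup h]
  exact SimplicialCpx.isShellable_blowup hπ isPure_circulant16 _ circulant16_exchange

theorem not_isVertexDecomposable_deletion_circulant16 (v : ZMod 16) :
    ¬ ((circulant 16 {1, 4, 8}).indComplex.deletion {v}).IsVertexDecomposable := by
  intro h
  obtain ⟨F, hF, hvF⟩ : ∃ F, (circulant 16 {1, 4, 8}).indComplex.IsFacet F ∧ v ∉ F := by
    -- A facet avoiding `v` survives in the deletion and fixes the sign as (-1)^4.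
    simp only [isFacet_circulant16_iff, exists_exists_and_eq_and, List.mem_toFinset]
    have : ∀ v : ZMod 16, ∃ L ∈ shelling16, v ∉ L := by decide +kernel
    exact this v
  have h1 := h.alternatingSum_nonneg F (hF.deletion hvF)
  rw [card_of_isFacet_circulant16 hF, alternatingSum_eq_indepLists circulant16_adj
    (l := verts16.filter (· ≠ v)) (nodup_verts16.filter _) fun A => ?_] at h1
  · have := alternatingSum_neg v
    norm_num at h1
    norm_num at this
    linarith
  · rw [SimplicialCpx.mem_deletion_singleton]
    refine and_congr_right fun _ => ?_
    simp only [List.mem_filter, mem_verts16, true_and, decide_eq_true_eq]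
    exact ⟨fun h w hw hwv => h (hwv ▸ hw), fun h hv => h v hv rfl⟩

theorem not_isVertexDecomposable_circulant16 :
    ¬ (circulant 16 {1, 4, 8}).indComplex.IsVertexDecomposable := by
  rintro (⟨_, -, hfacet⟩ | ⟨_, -, v, -, hdel, -⟩)
  · have h1 := isFacet_circulant16_iff.2 ⟨[0, 2, 5, 7], by decide +kernel, rfl⟩
    have h2 := isFacet_circulant16_iff.2 ⟨[8, 10, 13, 15], by decide +kernel, rfl⟩
    have hne : [0, 2, 5, 7].toFinset ≠ ([8, 10, 13, 15] : List (ZMod 16)).toFinset := by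
      decide +kernel
    exact hne (hfacet.unique h1 h2)
  · exact not_isVertexDecomposable_deletion_circulant16 v hdel

theorem not_isVertexDecomposable_of_cliques {V : Type*} [DecidableEq V] {G : SimpleGraph V}
    {π : V → ZMod 16} (hπ : Function.Surjective π) (h : ∀ p q, G.Adj p q ↔
      p ≠ q ∧ ((circulant 16 {1, 4, 8}).Adj (π p) (π q) ∨ π p = π q)) :
    ¬ G.IsVertexDecomposable := by
  rw [IsVertexDecomposable, indComplex_eq_blowup h]
  intro hvd
  have := hvd.of_blowup
  rw [Set.image_univ_of_surjective hπ, SimplicialCpx.restrict_univ] at this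
  exact not_isVertexDecomposable_circulant16 this

end SimpleGraph

/-! ### Lexicographical products with complete graphs -/

namespace SimpleGraph

theorem lexProduct_completeGraph_adj {V W : Type*} (G : SimpleGraph V) (p q : V × W) :
    (G.lexProduct (completeGraph W)).Adj p q ↔ p ≠ q ∧ (G.Adj p.1 q.1 ∨ p.1 = q.1) := by
  change G.Adj p.1 q.1 ∨ (p.1 = q.1 ∧ p.2 ≠ q.2) ↔ _
  rw [ne_eq p q, Prod.ext_iff]
  have : G.Adj p.1 q.1 → p.1 ≠ q.1 := fun h => h.ne
  tauto

/-- The lexicographical product of a circulant graph with a complete graph is circulant. -/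
theorem isCirculant_lexProduct_completeGraph (n m : ℕ) [NeZero n] [NeZero m] (S : Set ℕ) :
    ((circulant n S).lexProduct (completeGraph (Fin m))).IsCirculant := by
  let φ : ZMod (n * m) →+* ZMod n := ZMod.castHom (Dvd.intro m rfl) (ZMod n)
  let T : Set (ZMod n) := (fun k : ℕ => (k : ZMod n)) '' S
  -- Differences modulo `n` between equal or adjacent first coordinates; 0 accounts for the edges
  -- inside a clique.
  let U : Set (ZMod n) := {x | x = 0 ∨ x ∈ T ∨ -x ∈ T}
  -- Remainder and quotient on division by `n`. Adjacency in the product depends only on the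
  -- remainders and on distinctness, hence only on the difference modulo `n * m`.
  let f : ZMod (n * m) → ZMod n × Fin m := fun a =>
    (φ a, ⟨a.val / n, Nat.div_lt_of_lt_mul (ZMod.val_lt a)⟩)
  have hφ : ∀ a : ZMod (n * m), (φ a).val = a.val % n := fun a => by
    rw [ZMod.castHom_apply, ZMod.cast_eq_val, ZMod.val_natCast]
  have hf : Function.Bijective f := by
    rw [Fintype.bijective_iff_injective_and_card]
    refine ⟨fun a b hab => ?_, by simp [ZMod.card]⟩
    have h1 : φ a = φ b := congrArg Prod.fst hab
    have h2 : a.val / n = b.val / n := congrArg (fun p : ZMod n × Fin m => p.2.val) hab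
    refine ZMod.val_injective _ ?_
    rw [← Nat.div_add_mod a.val n, ← Nat.div_add_mod b.val n, h2, ← hφ, ← hφ, h1]
  have hpos : 0 < n * m := Nat.pos_of_neZero _
  refine ⟨n * m, {k | k ∈ Set.Icc 1 (n * m / 2) ∧ (k : ZMod n) ∈ U}, hpos,
    fun k hk => hk.1, ⟨RelIso.symm ⟨Equiv.ofBijective f hf, fun {a b} => ?_⟩⟩⟩
  have hneg : ∀ x : ZMod n, -x ∈ U ↔ x ∈ U := fun x => by
    simp only [U, Set.mem_ofPred_eq, neg_eq_zero, neg_neg]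
    tauto
  have hU : ∀ x : ZMod (n * m), x ≠ 0 → φ x ∈ U →
      x ∈ (fun k : ℕ => (k : ZMod (n * m))) '' {k | k ∈ Set.Icc 1 (n * m / 2) ∧ (k : ZMod n) ∈ U} ∨
      -x ∈ (fun k : ℕ => (k : ZMod (n * m))) ''
        {k | k ∈ Set.Icc 1 (n * m / 2) ∧ (k : ZMod n) ∈ U} := fun x hx hxU => by
    have key : ∀ y : ZMod (n * m), y ≠ 0 → φ y ∈ U → y.val ≤ n * m / 2 →
        y ∈ (fun k : ℕ => (k : ZMod (n * m))) ''
          {k | k ∈ Set.Icc 1 (n * m / 2) ∧ (k : ZMod n) ∈ U} := fun y hy hyU hle => by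
      refine ⟨y.val, ⟨⟨?_, hle⟩, ?_⟩, ZMod.natCast_zmod_val y⟩
      · exact Nat.one_le_iff_ne_zero.2 ((ZMod.val_ne_zero y).2 hy)
      · rwa [← map_natCast φ, ZMod.natCast_zmod_val]
    -- The representatives of `x` and `-x` add up to `n * m`, so one of them lies in the lower half;
    -- `U` is symmetric, so either may be used.
    by_cases hle : x.val ≤ n * m / 2
    · exact .inl (key x hx hxU hle)
    · refine .inr (key (-x) (neg_ne_zero.2 hx) (by rwa [map_neg, hneg]) ?_)
      have : NeZero x := ⟨hx⟩
      rw [ZMod.val_neg_of_ne_zero]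
      omega
  have hU' : ∀ x : ZMod (n * m), x ∈ (fun k : ℕ => (k : ZMod (n * m))) ''
      {k | k ∈ Set.Icc 1 (n * m / 2) ∧ (k : ZMod n) ∈ U} → φ x ∈ U := by
    rintro _ ⟨k, hk, rfl⟩
    simpa using hk.2
  rw [lexProduct_completeGraph_adj]
  simp only [Equiv.ofBijective_apply, circulant, circulantGraph_adj, hf.1.ne_iff]
  have hUab : φ (a - b) ∈ U ↔
      ((f a).1 ≠ (f b).1 ∧ ((f a).1 - (f b).1 ∈ T ∨ (f b).1 - (f a).1 ∈ T)) ∨ (f a).1 = (f b).1 := by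
    change (φ (a - b) = 0 ∨ φ (a - b) ∈ T ∨ -φ (a - b) ∈ T) ↔
      (φ a ≠ φ b ∧ (φ a - φ b ∈ T ∨ φ b - φ a ∈ T)) ∨ φ a = φ b
    rw [map_sub, neg_sub, sub_eq_zero]
    tauto
  change (a ≠ b ∧ (((f a).1 ≠ (f b).1 ∧ ((f a).1 - (f b).1 ∈ T ∨ (f b).1 - (f a).1 ∈ T)) ∨
    (f a).1 = (f b).1)) ↔ _
  rw [← hUab]
  refine and_congr_right fun hab => ⟨fun h => ?_, ?_⟩
  · have := hU (a - b) (sub_ne_zero.2 hab) h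
    rwa [neg_sub] at this
  · rintro (h | h)
    · exact hU' _ h
    · rw [← hneg, ← map_neg, neg_sub]
      exact hU' _ h

/-- The expansion with constant multiplicities is the lexicographical product with a complete
graph. -/
def expansionIsoLexProduct {V : Type*} (G : SimpleGraph V) (m : ℕ) :
    G.expansion (fun _ => m) ≃g G.lexProduct (completeGraph (Fin m)) where
  toEquiv := Equiv.sigmaEquivProd V (Fin m)
  map_rel_iff' {p q} := by
    rw [lexProduct_completeGraph_adj, (Equiv.sigmaEquivProd V (Fin m)).injective.ne_iff]
    rfl

end SimpleGraph

theorem theorem4p4 :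
    (∀ s : ZMod 16 → ℕ, (∀ i, 1 ≤ s i) →
      ((SimpleGraph.circulant 16 {1, 4, 8}).expansion s).IsShellable ∧
      ¬ ((SimpleGraph.circulant 16 {1, 4, 8}).expansion s).IsVertexDecomposable) ∧
    (∀ m : ℕ, 1 ≤ m →
      (∃ e : (SimpleGraph.circulant 16 {1, 4, 8}).expansion (fun _ => m) ≃g
          (SimpleGraph.circulant 16 {1, 4, 8}).lexProduct (SimpleGraph.completeGraph (Fin m)),
        ∀ p, e p = (p.1, p.2)) ∧
      ((SimpleGraph.circulant 16 {1, 4, 8}).lexProduct (SimpleGraph.completeGraph (Fin m))).IsCirculant ∧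
      ((SimpleGraph.circulant 16 {1, 4, 8}).lexProduct (SimpleGraph.completeGraph (Fin m))).IsShellable ∧
      ¬ ((SimpleGraph.circulant 16 {1, 4, 8}).lexProduct
          (SimpleGraph.completeGraph (Fin m))).IsVertexDecomposable) ∧
    (∀ m m' : ℕ, 1 ≤ m → 1 ≤ m' →
      Nonempty ((SimpleGraph.circulant 16 {1, 4, 8}).lexProduct (SimpleGraph.completeGraph (Fin m)) ≃g
        (SimpleGraph.circulant 16 {1, 4, 8}).lexProduct (SimpleGraph.completeGraph (Fin m'))) →
      m = m') := by
  refine ⟨fun s hs => ?_, fun m hm => ?_, fun m m' _ _ ⟨e⟩ => ?_⟩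
  · have hπ : Function.Surjective (Sigma.fst : (Σ i : ZMod 16, Fin (s i)) → ZMod 16) :=
      fun i => ⟨⟨i, ⟨0, hs i⟩⟩, rfl⟩
    exact ⟨SimpleGraph.isShellable_of_cliques hπ fun _ _ => Iff.rfl,
      SimpleGraph.not_isVertexDecomposable_of_cliques hπ fun _ _ => Iff.rfl⟩
  · have : NeZero m := ⟨by omega⟩
    have hπ : Function.Surjective (Prod.fst : ZMod 16 × Fin m → ZMod 16) :=
      fun i => ⟨(i, 0), rfl⟩
    exact ⟨⟨SimpleGraph.expansionIsoLexProduct _ m, fun _ => rfl⟩,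
      SimpleGraph.isCirculant_lexProduct_completeGraph 16 m _,
      SimpleGraph.isShellable_of_cliques hπ (SimpleGraph.lexProduct_completeGraph_adj _),
      SimpleGraph.not_isVertexDecomposable_of_cliques hπ
        (SimpleGraph.lexProduct_completeGraph_adj _)⟩
  -- Counting vertices gives `16 * m = 16 * m'`.
  · have := Fintype.card_congr e.toEquiv
    simpa [ZMod.card] using this
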